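/- Let $\Sigma$ be an alphabet with exactly three letters, and let $k\ge 2$. For words $u,v\in\Sigma^*$ write $u\preceq v$ if $u$ is a scattered factor (subsequence) of $v$, and write $u\sim_j v$ if $u$ and $v$ have the same scattered factors of length at most $j$ (for $j\le 0$ this always holds). Let $\mathrm{alph}(u)$ be the set of letters of $u$. For $\Omega\subseteq\Sigma$ nonempty, $\iota_\Omega(u)$ is the largest $m$ such that every word of length $m$ over $\Omega$ is a scattered factor of $u$. The arch factorization of $u\in\Omega^*$ with respect to $\Omega$ is $u=\mathrm{ar}_1(u)\cdots\mathrm{ar}_m(u)\,\mathrm{re}(u)$, where each arch $\mathrm{ar}_i(u)$ contains all letters of $\Omega$, the last letter of each arch occurs in it exactly once, and the rest $\mathrm{re}(u)$ does not contain all letters of $\Omega$; the modus $\mathrm m(u)$ is the word of the last letters of the arches. Applied to the reversal $u^R$ and reversed back, this gives the reverse arches, the reverse rest $\overline{\mathrm{re}}(u)=(\mathrm{re}(u^R))^R$ and the reverse modus $\overline{\mathrm m}(u)=(\mathrm m(u^R))^R$. A word $w\in\Sigma^*$ with $\iota_\Sigma(w)=1$ has the unique factorization $w=\alpha_0\beta\alpha_1$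 in which $\alpha_0\beta$ is the arch, $\alpha_1$ the rest, $\beta\alpha_1$ the reverse arch and $\alpha_0$ the reverse rest of $w$ with respect to $\Sigma$. Let $\mathrm{core}$ be $\beta$ without its first and last letter (empty if $|\beta|\le 2$). Since $|\mathrm{alph}(\alpha_i)|\le 2$, choose $\Omega_i\subseteq\Sigma$ with $|\Omega_i|=2$ and $\mathrm{alph}(\alpha_i)\subseteq\Omega_i$, and let $\iota(\alpha_i)$, $\mathrm{re}(\alpha_0)$, $\overline{\mathrm{re}}(\alpha_1)$ be taken with respect to $\Omega_i$ (they do not depend on the choice). **Theorem.** Let $w,\tilde w\in\Sigma^*$ with $\iota_\Sigma(w)=\iota_\Sigma(\tilde w)=1$, with factorizations $w=\alpha_0\beta\alpha_1$ and $\tilde w=\tilde\alpha_0\tilde\beta\tilde\alpha_1$. Then $w\sim_k\tilde w$ if and only if $\alpha_i\sim_{k-1}\tilde\alpha_i$ for $i=0,1$ and at least one of the following holds: 1. for some $i\in\{0,1\}$: $|\mathrm{alph}(\alpha_i)|=2$, $\mathrm{alph}(\alpha_{1-i})\cap\mathrm{alph}(\alpha_i)=\emptyset$ and $\iota(\alpha_i)\ge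 k-1$; 2. $\mathrm m(w)=\mathrm m(\tilde w)$, $\overline{\mathrm m}(w)=\overline{\mathrm m}(\tilde w)$, and $\mathrm{core}\sim_{k-c}\widetilde{\mathrm{core}}$, where $$c=\iota(\alpha_0)+\delta_{y\preceq\mathrm{re}(\alpha_0)}+\iota(\alpha_1)+\delta_{y\preceq\overline{\mathrm{re}}(\alpha_1)},$$ $y$ is the letter of $\Sigma$ different from $\mathrm m(w)$ and $\overline{\mathrm m}(w)$, and $\delta_P$ is $1$ if $P$ holds and $0$ otherwise. (Both cores are powers of $y$; if $\mathrm m(w)=\overline{\mathrm m}(w)$, both cores are empty and the condition on them is void.) -/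

import Mathlib

/-! Words over an alphabet `σ` are lists; `u` is a scattered factor of `w` iff `u.Sublist w`;
the set of letters of `w` is `w.toFinset`. -/

namespace Simon

variable {σ : Type*}

/-- The scattered factors of `w` of length at most `k`. -/
def scatFactLE (k : ℕ) (w : List σ) : Set (List σ) :=
  {v | v.Sublist w ∧ v.length ≤ k}

/-- Simon's congruence of level `k`. -/
def Congr (k : ℕ) (u v : List σ) : Prop :=
  scatFactLE k u = scatFactLE k v

/-- `w` is `k`-universal with respect to `Ω`: every word of length `k` over `Ω` is a scattered
factor of `w`. -/
def IsUniversal (Ω : Finset σ) (k : ℕ) (w : List σ) : Prop :=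
  ∀ v : List σ, v.length = k → (∀ a ∈ v, a ∈ Ω) → v.Sublist w

/-- The universality index with respect to `Ω`: the largest `k` such that `w` is `k`-universal
(for `Ω` nonempty such `k` are bounded by the length of `w`, and `0` is always one of them). -/
noncomputable def univIndex (Ω : Finset σ) (w : List σ) : ℕ :=
  sSup {k | IsUniversal Ω k w}

variable [DecidableEq σ]

/-- Greedy reading from left to right: `cur` is the part of the current arch read so far, and the
arch is closed as soon as it contains every letter of `Ω`. Returns the arches and the rest. -/
def archAux (Ω : Finset σ) : List σ → List σ → List (List σ) × List σ
  | cur, [] => ([], cur)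
  | cur, a :: w =>
    if Ω ⊆ (cur ++ [a]).toFinset then
      ((cur ++ [a]) :: (archAux Ω [] w).1, (archAux Ω [] w).2)
    else archAux Ω (cur ++ [a]) w

/-- The arches of `w` with respect to `Ω`. -/
def arches (Ω : Finset σ) (w : List σ) : List (List σ) := (archAux Ω [] w).1

/-- The rest `re(w)` of the arch factorization with respect to `Ω`. -/
def rest (Ω : Finset σ) (w : List σ) : List σ := (archAux Ω [] w).2

/-- The modus `m(w)`: the word of the last letters of the arches. -/
def modus (Ω : Finset σ) (w : List σ) : List σ := (arches Ω w).filterMap List.getLast?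

/-- The reverse arches, listed from left to right. -/
def revArches (Ω : Finset σ) (w : List σ) : List (List σ) :=
  ((arches Ω w.reverse).map List.reverse).reverse

/-- The reverse rest. -/
def revRest (Ω : Finset σ) (w : List σ) : List σ := (rest Ω w.reverse).reverse

/-- The reverse modus. -/
def revModus (Ω : Finset σ) (w : List σ) : List σ := (modus Ω w.reverse).reverse

theorem archAux_spec (Ω : Finset σ) (w : List σ) : ∀ cur : List σ, ¬ Ω ⊆ cur.toFinset →
    (archAux Ω cur w).1.flatten ++ (archAux Ω cur w).2 = cur ++ w ∧
    (∀ A ∈ (archAux Ω cur w).1, Ω ⊆ A.toFinset ∧ ¬ Ω ⊆ A.dropLast.toFinset) ∧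
    ¬ Ω ⊆ (archAux Ω cur w).2.toFinset := by
  induction w with
  | nil => intro cur h; simpa [archAux] using h
  | cons a w ih =>
    intro cur h
    have h0 : ¬ Ω ⊆ ([] : List σ).toFinset := fun h' => h (h'.trans (by simp))
    unfold archAux
    split_ifs with hc
    · obtain ⟨h1, h2, h3⟩ := ih [] h0
      refine ⟨?_, ?_, h3⟩
      · simp only [List.flatten_cons, List.append_assoc, h1]
        simp
      · intro A hA
        rcases List.mem_cons.1 hA with rfl | hA
        · exact ⟨hc, by simpa using h⟩
        · exact h2 A hA
    · obtain ⟨h1, h2, h3⟩ := ih (cur ++ [a]) hc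
      exact ⟨by simpa using h1, h2, h3⟩

/-- Over a nonempty alphabet the arches are shortest factors containing all of `Ω`, the rest misses
a letter of `Ω`, and together they factorize `w`. -/
theorem arches_spec (Ω : Finset σ) (hΩ : Ω.Nonempty) (w : List σ) :
    (arches Ω w).flatten ++ rest Ω w = w ∧
    (∀ A ∈ arches Ω w, Ω ⊆ A.toFinset ∧ ¬ Ω ⊆ A.dropLast.toFinset) ∧
    ¬ Ω ⊆ (rest Ω w).toFinset := by
  have h := archAux_spec Ω w [] (by simpa [Finset.subset_empty] using hΩ.ne_empty)
  simpa [arches, rest] using h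

variable [Fintype σ]

mutual

/-- The factor `α_i` of the `α`-`β`-factorization with respect to the whole alphabet:
`α_0` is the reverse rest, and `β_i α_i` is the `i`-th reverse arch. -/
def alpha (w : List σ) : ℕ → List σ
  | 0 => revRest Finset.univ w
  | i + 1 => ((revArches Finset.univ w).getD i []).drop (beta w (i + 1)).length

/-- The factor `β_i` (for `i ≥ 1`): `α_{i-1} β_i` is the `i`-th arch. -/
def beta (w : List σ) : ℕ → List σ
  | 0 => []
  | i + 1 => ((arches Finset.univ w).getD i []).drop (alpha w i).length

end

/-- `core_i`: the factor `β_i` without its first and last letter (empty if `β_i` has length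
at most two). -/
def core (w : List σ) (i : ℕ) : List σ := (beta w i).tail.dropLast

end Simon

-- Elementary facts about Simon's congruence and greedy embeddings

namespace Simon

variable {σ : Type*}

-- Write w = AβB with A = α₀, B = α₁, and let a and b be the first and last letter of β; these are
-- the reverse modus and the modus. The last a of w stands right after A, so `ua` embeds into w iff
-- u embeds into A. On the other hand βB contains every letter, so u in A gives `uc` in w for every
-- letter c. Playing these two facts against each other yields α_i ∼_{k-1} α̃_i (`congr_left`,
-- `congr_right`).
--
-- If the reverse moduli a ≠ a' differ, a' must occur in β after a. Then any short u in A gives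
-- `uaa'` in w, hence `ua` in A; the symmetric argument adds a'. So A is (k-1)-universal over {a,
-- a'} and B avoids both letters: alternative 1 (`universal_of_head_ne`). Different moduli are the
-- mirror image. Conversely, under alternative 1 the factors of length at most k are determined by A
-- and B alone (`sublist_of_universal`).
--
-- If both moduli agree and a ≠ b, then β = a yⁿ b, and the question is up to which threshold n is
-- visible at level k. Let c₀ = ι(A) + δ be the left part of c. Every factor of Aa shorter than c₀
-- can be extended by y inside Aa, so surplus y's can be absorbed there
-- (`append_singleton_sublist_of_length_lt`). Some factor u of length exactly c₀ leaves no y behind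
-- (`exists_isBlocking`). The same holds on the right with c₁ and a word v. Testing with u y^j v
-- shows that n is detected up to k - c₀ - c₁, and absorption shows that it is not detected beyond.
-- Replacing A and B by (k-1)-congruent words is harmless, since the remainder of the word contains
-- all letters (`congr_append_right`).

theorem Congr.sublist {k : ℕ} {u v x : List σ} (h : Congr k u v) (hx : x.Sublist u)
    (hl : x.length ≤ k) : x.Sublist v := by
  have : x ∈ scatFactLE k u := ⟨hx, hl⟩
  rw [h] at this
  exact this.1

theorem congr_of_sublist {k : ℕ} {u v : List σ}
    (h₁ : ∀ x : List σ, x.Sublist u → x.length ≤ k → x.Sublist v)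
    (h₂ : ∀ x : List σ, x.Sublist v → x.length ≤ k → x.Sublist u) : Congr k u v := by
  ext x
  exact ⟨fun h => ⟨h₁ x h.1 h.2, h.2⟩, fun h => ⟨h₂ x h.1 h.2, h.2⟩⟩

theorem Congr.symm {k : ℕ} {u v : List σ} (h : Congr k u v) : Congr k v u := Eq.symm h

theorem Congr.trans {k : ℕ} {u v w : List σ} (h : Congr k u v) (h' : Congr k v w) :
    Congr k u w := Eq.trans h h'

theorem Congr.mem_iff {k : ℕ} {u v : List σ} (h : Congr k u v) (hk : 1 ≤ k) (a : σ) :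
    a ∈ u ↔ a ∈ v := by
  constructor <;> intro ha
  · simpa using h.sublist (List.singleton_sublist.2 ha) (by simpa using hk)
  · simpa using h.symm.sublist (List.singleton_sublist.2 ha) (by simpa using hk)

theorem Congr.reverse {k : ℕ} {u v : List σ} (h : Congr k u v) :
    Congr k u.reverse v.reverse := by
  apply congr_of_sublist
  · intro x hx hl
    have := h.sublist (x := x.reverse) (by simpa using hx.reverse) (by simpa using hl)
    simpa using this.reverse
  · intro x hx hl
    have := h.symm.sublist (x := x.reverse) (by simpa using hx.reverse) (by simpa using hl)
    simpa using this.reverse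

theorem congr_reverse_iff {k : ℕ} {u v : List σ} :
    Congr k u.reverse v.reverse ↔ Congr k u v :=
  ⟨fun h => by simpa using h.reverse, Congr.reverse⟩

theorem reverse_sublist_comm {u v : List σ} : u.reverse.Sublist v ↔ u.Sublist v.reverse := by
  rw [← List.reverse_sublist, List.reverse_reverse]

/-- The greedy embedding of a first letter. -/
theorem cons_sublist_append_cons_iff {a : σ} {D u R : List σ} (ha : a ∉ D) :
    (a :: u).Sublist (D ++ a :: R) ↔ u.Sublist R := by
  induction D with
  | nil => simp
  | cons d D ih =>
    simp only [List.mem_cons, not_or] at ha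
    rw [← ih ha.2]
    constructor
    · intro h
      cases h with
      | cons _ h => exact h
      | cons_cons _ h => exact absurd rfl ha.1
    · intro h
      exact h.cons _

theorem append_singleton_sublist_iff {a : σ} {u R E : List σ} (ha : a ∉ E) :
    (u ++ [a]).Sublist (R ++ a :: E) ↔ u.Sublist R := by
  rw [← List.reverse_sublist, ← List.reverse_sublist (l₁ := u)]
  simpa using cons_sublist_append_cons_iff (u := u.reverse) (R := R.reverse)
    (D := E.reverse) (a := a) (by simpa using ha)

/-! ### Universality and arches -/

theorem IsUniversal.sublist {Ω : Finset σ} {m : ℕ} {w v : List σ} (hΩ : Ω.Nonempty)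
    (h : IsUniversal Ω m w) (hl : v.length ≤ m) (hv : ∀ a ∈ v, a ∈ Ω) : v.Sublist w := by
  obtain ⟨d, hd⟩ := hΩ
  refine (List.sublist_append_left v (List.replicate (m - v.length) d)).trans (h _ ?_ ?_)
  · simp; omega
  · intro a ha
    rcases List.mem_append.1 ha with ha | ha
    · exact hv a ha
    · rw [List.eq_of_mem_replicate ha]; exact hd

theorem isUniversal_reverse {Ω : Finset σ} {m : ℕ} {w : List σ} :
    IsUniversal Ω m w.reverse ↔ IsUniversal Ω m w := by
  have key : ∀ w : List σ, IsUniversal Ω m w → IsUniversal Ω m w.reverse := fun w h v hl hv =>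
    reverse_sublist_comm.1 (h v.reverse (by simpa using hl) (by simpa using hv))
  exact ⟨fun h => by simpa using key _ h, key w⟩

theorem univIndex_reverse (Ω : Finset σ) (w : List σ) :
    univIndex Ω w.reverse = univIndex Ω w := by
  simp only [univIndex, isUniversal_reverse]

theorem le_univIndex_iff {Ω : Finset σ} (hΩ : Ω.Nonempty) {m : ℕ} {w : List σ} :
    m ≤ univIndex Ω w ↔ IsUniversal Ω m w := by
  have hb : BddAbove {k | IsUniversal Ω k w} := by
    obtain ⟨d, hd⟩ := hΩ
    refine ⟨w.length, fun k hk => ?_⟩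
    have := hk (List.replicate k d) (by simp) (fun a ha => by
      rw [List.eq_of_mem_replicate ha]; exact hd)
    simpa using this.length_le
  have hne : {k | IsUniversal Ω k w}.Nonempty :=
    ⟨0, fun v hl _ => by rw [List.length_eq_zero_iff.1 hl]; exact List.nil_sublist _⟩
  constructor
  · intro h v hl hv
    exact IsUniversal.sublist hΩ (Nat.sSup_mem hne hb) (hl.le.trans h) hv
  · intro h
    exact le_csSup hb h

variable [DecidableEq σ]

theorem sublist_flatten_of_length_le {Ω : Finset σ} : ∀ {L : List (List σ)},
    (∀ A ∈ L, Ω ⊆ A.toFinset) → ∀ {v : List σ}, v.length ≤ L.length → (∀ a ∈ v, a ∈ Ω) →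
    v.Sublist L.flatten
  | _, _, [], _, _ => List.nil_sublist _
  | [], _, _ :: _, hl, _ => by simp at hl
  | A :: L, hL, a :: v, hl, hv => by
    have h1 : [a].Sublist A := List.singleton_sublist.2
      (List.mem_toFinset.1 (hL A (by simp) (hv a (by simp))))
    have h2 := sublist_flatten_of_length_le (L := L) (fun B hB => hL B (by simp [hB]))
      (v := v) (by simpa using hl) (fun b hb => hv b (by simp [hb]))
    simpa using h1.append h2

theorem exists_eq_append_singleton {Ω : Finset σ} {A : List σ} (h1 : Ω ⊆ A.toFinset)
    (h2 : ¬ Ω ⊆ A.dropLast.toFinset) : ∃ D a, A = D ++ [a] ∧ a ∉ D := by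
  rcases List.eq_nil_or_concat A with rfl | ⟨D, a, rfl⟩
  · exact absurd h1 h2
  · refine ⟨D, a, by simp, fun ha => h2 fun c hc => ?_⟩
    have := h1 hc
    simp only [List.concat_eq_append, List.toFinset_append, Finset.mem_union,
      List.mem_toFinset, List.mem_singleton] at this
    rcases this with h | rfl
    · simpa using h
    · simpa using ha

/-- The modus is the greedy word: after it only the rest is left. -/
theorem filterMap_getLast_append_sublist_iff {Ω : Finset σ} {R s : List σ} :
    ∀ {L : List (List σ)}, (∀ A ∈ L, Ω ⊆ A.toFinset ∧ ¬ Ω ⊆ A.dropLast.toFinset) →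
    ((L.filterMap List.getLast? ++ s).Sublist (L.flatten ++ R) ↔ s.Sublist R)
  | [], _ => by simp
  | A :: L, hL => by
    obtain ⟨D, a, rfl, ha⟩ := exists_eq_append_singleton (hL A (by simp)).1 (hL A (by simp)).2
    refine Iff.trans ?_
      (filterMap_getLast_append_sublist_iff (L := L) (fun B hB => hL B (by simp [hB])))
    simpa using cons_sublist_append_cons_iff (u := L.filterMap List.getLast? ++ s)
      (R := L.flatten ++ R) ha

theorem modus_append_sublist_iff {Ω : Finset σ} (hΩ : Ω.Nonempty) {w s x : List σ} :
    (modus Ω w ++ s).Sublist (w ++ x) ↔ s.Sublist (rest Ω w ++ x) := by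
  obtain ⟨h1, h2, -⟩ := arches_spec Ω hΩ w
  have h := filterMap_getLast_append_sublist_iff (R := rest Ω w ++ x) (s := s) h2
  rwa [← List.append_assoc, h1] at h

theorem modus_sublist {Ω : Finset σ} (hΩ : Ω.Nonempty) (w : List σ) :
    (modus Ω w).Sublist w := by
  simpa using (modus_append_sublist_iff hΩ (w := w) (s := []) (x := [])).2 (List.nil_sublist _)

theorem length_filterMap_getLast {Ω : Finset σ} : ∀ {L : List (List σ)},
    (∀ A ∈ L, Ω ⊆ A.toFinset ∧ ¬ Ω ⊆ A.dropLast.toFinset) →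
    (L.filterMap List.getLast?).length = L.length
  | [], _ => rfl
  | A :: L, hL => by
    obtain ⟨D, a, rfl, -⟩ := exists_eq_append_singleton (hL A (by simp)).1 (hL A (by simp)).2
    simpa using length_filterMap_getLast (L := L) (fun B hB => hL B (by simp [hB]))

theorem length_modus {Ω : Finset σ} (hΩ : Ω.Nonempty) (w : List σ) :
    (modus Ω w).length = (arches Ω w).length :=
  length_filterMap_getLast (arches_spec Ω hΩ w).2.1

theorem sublist_flatten_arches {Ω : Finset σ} (hΩ : Ω.Nonempty) {w v : List σ}
    (hl : v.length ≤ (arches Ω w).length) (hv : ∀ a ∈ v, a ∈ Ω) :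
    v.Sublist (arches Ω w).flatten :=
  sublist_flatten_of_length_le (fun A hA => ((arches_spec Ω hΩ w).2.1 A hA).1) hl hv

theorem mem_of_mem_arches_getLast {Ω : Finset σ} {A : List σ} {a : σ} (h1 : Ω ⊆ A.toFinset)
    (h2 : ¬ Ω ⊆ A.dropLast.toFinset) (h : A.getLast? = some a) : a ∈ Ω := by
  obtain ⟨D, b, rfl, -⟩ := exists_eq_append_singleton h1 h2
  obtain rfl : b = a := by simpa using h
  by_contra hb
  refine h2 fun c hc => ?_
  have := h1 hc
  simp only [List.toFinset_append, Finset.mem_union, List.mem_toFinset,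
    List.mem_singleton] at this
  rcases this with h | rfl
  · simpa using h
  · exact absurd hc hb

theorem mem_alphabet_of_mem_modus {Ω : Finset σ} (hΩ : Ω.Nonempty) {w : List σ} {a : σ}
    (h : a ∈ modus Ω w) : a ∈ Ω := by
  obtain ⟨A, hA, ha⟩ := List.mem_filterMap.1 h
  obtain ⟨h1, h2⟩ := (arches_spec Ω hΩ w).2.1 A hA
  exact mem_of_mem_arches_getLast h1 h2 ha

/-- The modus followed by a letter of `Ω` missing from the rest does not embed, which bounds
universality from above; one letter per arch gives the lower bound. -/
theorem univIndex_eq_length_arches {Ω : Finset σ} (hΩ : Ω.Nonempty) (w : List σ) :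
    univIndex Ω w = (arches Ω w).length := by
  obtain ⟨h1, h2, h3⟩ := arches_spec Ω hΩ w
  apply le_antisymm
  · by_contra! hlt
    obtain ⟨d, hd, hdr⟩ := Finset.not_subset.1 h3
    have := (le_univIndex_iff hΩ).1 (Nat.succ_le_of_lt hlt) (modus Ω w ++ [d])
      (by simp [length_modus hΩ]) (by
        intro a ha
        rcases List.mem_append.1 ha with ha | ha
        · exact mem_alphabet_of_mem_modus hΩ ha
        · rw [List.mem_singleton.1 ha]; exact hd)
    have h := (modus_append_sublist_iff hΩ (x := [])).1 (by simpa using this)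
    exact hdr (by simpa using h)
  · rw [le_univIndex_iff hΩ]
    intro v hl hv
    rw [← h1]
    exact (sublist_flatten_arches hΩ hl.le hv).trans (List.sublist_append_left _ _)

theorem archAux_eq_of_not_subset {Ω : Finset σ} {w : List σ} : ∀ {cur : List σ},
    ¬ Ω ⊆ (cur ++ w).toFinset → archAux Ω cur w = ([], cur ++ w) := by
  induction w with
  | nil => intro cur _; simp [archAux]
  | cons a w ih =>
    intro cur h
    have h1 : ¬ Ω ⊆ (cur ++ [a]).toFinset := fun h' => h (h'.trans fun x hx => by
      simp only [List.mem_toFinset, List.mem_append, List.mem_cons, List.not_mem_nil,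
        or_false] at hx ⊢
      tauto)
    rw [archAux, if_neg h1, ih (by simpa using h)]
    simp

theorem rest_eq_self {Ω : Finset σ} {w : List σ} (h : ¬ Ω ⊆ w.toFinset) : rest Ω w = w := by
  simp [rest, archAux_eq_of_not_subset (cur := []) h]

theorem arches_eq_nil {Ω : Finset σ} {w : List σ} (h : ¬ Ω ⊆ w.toFinset) : arches Ω w = [] := by
  simp [arches, archAux_eq_of_not_subset (cur := []) h]

end Simon

-- Words with one arch: congruence of the outer factors, and unequal moduli

namespace Simon

variable {σ : Type*}

theorem eq_or_eq_of_ne [Fintype σ] (hσ : Fintype.card σ = 3) {x y z : σ} (hxy : x ≠ y)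
    (hxz : x ≠ z) (hyz : y ≠ z) (c : σ) : c = x ∨ c = y ∨ c = z := by
  classical
  have h : ({x, y, z} : Finset σ) = Finset.univ := by
    apply Finset.eq_univ_of_card
    rw [hσ, Finset.card_eq_three]
    exact ⟨x, y, z, hxy, hxz, hyz, rfl⟩
  have := Finset.mem_univ c
  rw [← h] at this
  simpa using this

/-- `A β B` is the factorization of a word with one arch: `βB` is the shortest suffix and `Aβ` the
shortest prefix containing all letters; `a` and `b` are the first and the last letter of `β`. -/
structure IsFactorization (A β B : List σ) (a b : σ) : Prop where
  head : ∃ E, β = a :: E ∧ a ∉ E ∧ a ∉ B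
  last : ∃ D, β = D ++ [b] ∧ b ∉ D ∧ b ∉ A
  left : ∀ c, c ∈ A ++ β
  right : ∀ c, c ∈ β ++ B

namespace IsFactorization

variable {A β B A' β' B' : List σ} {a b a' b' : σ}

theorem reverse (h : IsFactorization A β B a b) :
    IsFactorization B.reverse β.reverse A.reverse b a := by
  obtain ⟨⟨E, hE, h1, h2⟩, ⟨D, hD, h3, h4⟩, h5, h6⟩ := h
  refine ⟨⟨D.reverse, by simp [hD], by simpa using h3, by simpa using h4⟩,
    ⟨E.reverse, by simp [hE], by simpa using h1, by simpa using h2⟩, fun c => ?_, fun c => ?_⟩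
  · have := h6 c
    simp only [List.mem_append, List.mem_reverse] at this ⊢
    tauto
  · have := h5 c
    simp only [List.mem_append, List.mem_reverse] at this ⊢
    tauto

/-- The first letter of β occurs nowhere later in the word, so it marks the end of A. -/
theorem append_head_sublist_iff (h : IsFactorization A β B a b) {u : List σ} :
    (u ++ [a]).Sublist (A ++ β ++ B) ↔ u.Sublist A := by
  obtain ⟨E, rfl, h1, h2⟩ := h.head
  simpa using append_singleton_sublist_iff (u := u) (R := A) (E := E ++ B) (a := a)
    (by simp [h1, h2])

theorem append_singleton_sublist (h : IsFactorization A β B a b) {u : List σ}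
    (hu : u.Sublist A) (c : σ) : (u ++ [c]).Sublist (A ++ β ++ B) := by
  rw [List.append_assoc]
  exact hu.append (List.singleton_sublist.2 (h.right c))

theorem congr_left (h : IsFactorization A β B a b) (h' : IsFactorization A' β' B' a' b') {k : ℕ}
    (hk : 1 ≤ k) (hc : Congr k (A ++ β ++ B) (A' ++ β' ++ B')) : Congr (k - 1) A A' := by
  apply congr_of_sublist
  · intro x hx hl
    exact h'.append_head_sublist_iff.1
      (hc.sublist (h.append_singleton_sublist hx a') (by simp; omega))
  · intro x hx hl
    exact h.append_head_sublist_iff.1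
      (hc.symm.sublist (h'.append_singleton_sublist hx a) (by simp; omega))

theorem congr_right (h : IsFactorization A β B a b) (h' : IsFactorization A' β' B' a' b')
    {k : ℕ} (hk : 1 ≤ k) (hc : Congr k (A ++ β ++ B) (A' ++ β' ++ B')) : Congr (k - 1) B B' := by
  rw [← congr_reverse_iff]
  exact h.reverse.congr_left h'.reverse hk (by simpa using hc.reverse)

theorem sublist_left_of_append_head_sublist (h : IsFactorization A β B a b)
    (h' : IsFactorization A' β' B' a' b') {k : ℕ}
    (hk : 2 ≤ k) (hc : Congr k (A ++ β ++ B) (A' ++ β' ++ B')) {u : List σ}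
    (hl : u.length ≤ k - 1) (hu : (u ++ [a']).Sublist (A ++ β ++ B)) : u.Sublist A :=
  (h.congr_left h' (by omega) hc).symm.sublist
    (h'.append_head_sublist_iff.1 (hc.sublist hu (by simp; omega))) hl

/-- Otherwise `ba'` would embed, forcing b into A. -/
theorem not_mem_right_of_ne (h : IsFactorization A β B a b)
    (h' : IsFactorization A' β' B' a' b') {k : ℕ} (hk : 2 ≤ k)
    (hc : Congr k (A ++ β ++ B) (A' ++ β' ++ B')) : a' ∉ B := by
  intro hm
  obtain ⟨D, hD, -, hb⟩ := h.last
  have : ([b] ++ [a']).Sublist (A ++ β ++ B) :=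
    List.Sublist.append (List.singleton_sublist.2 (by simp [hD])) (List.singleton_sublist.2 hm)
  exact hb (by simpa using h.sublist_left_of_append_head_sublist h' hk hc (by simp; omega) this)

/-- Since a' lies in β behind a, the word `uaa'` embeds, and its final a' acts as the end marker of
the other word. -/
theorem append_head_sublist_of_ne (h : IsFactorization A β B a b)
    (h' : IsFactorization A' β' B' a' b') {k : ℕ} (hk : 2 ≤ k)
    (hc : Congr k (A ++ β ++ B) (A' ++ β' ++ B')) (hne : a ≠ a') {u : List σ}
    (hl : u.length < k - 1) (hu : u.Sublist A) : (u ++ [a]).Sublist A := by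
  apply h.sublist_left_of_append_head_sublist h' hk hc (by simp; omega)
  have hm : a' ∈ β := (List.mem_append.1 (h.right a')).resolve_right
    (h.not_mem_right_of_ne h' hk hc)
  obtain ⟨E, rfl, -, -⟩ := h.head
  have hm' : a' ∈ E := by simpa [hne.symm] using hm
  have h1 : (u ++ ([a] ++ [a'])).Sublist (A ++ (a :: E)) :=
    hu.append (by simpa using hm')
  simpa using h1.trans (List.sublist_append_left _ B)

theorem sublist_of_head_ne (h : IsFactorization A β B a b)
    (h' : IsFactorization A' β' B' a' b') {k : ℕ} (hk : 2 ≤ k)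
    (hc : Congr k (A ++ β ++ B) (A' ++ β' ++ B')) (hne : a ≠ a') :
    ∀ {u : List σ}, u.length ≤ k - 1 → (∀ c ∈ u, c = a ∨ c = a') → u.Sublist A := by
  intro u
  induction u using List.reverseRecOn with
  | nil => intros; exact List.nil_sublist _
  | append_singleton u c ih =>
    intro hl hu
    simp only [List.length_append, List.length_singleton] at hl
    have hu' := ih (by omega) (fun d hd => hu d (by simp [hd]))
    have hA := h.congr_left h' (by omega) hc
    rcases hu c (by simp) with rfl | rfl
    · exact h.append_head_sublist_of_ne h' hk hc hne (by omega) hu'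
    -- The letter a' is appended inside A', where it plays the role of a, and the result is carried
    -- back to A.
    · exact hA.symm.sublist (h'.append_head_sublist_of_ne h hk hc.symm hne.symm (by omega)
        (hA.sublist hu' (by omega))) (by simp; omega)

variable [DecidableEq σ]

theorem universal_of_head_ne [Fintype σ] (hσ : Fintype.card σ = 3)
    (h : IsFactorization A β B a b)
    (h' : IsFactorization A' β' B' a' b') {k : ℕ} (hk : 2 ≤ k)
    (hc : Congr k (A ++ β ++ B) (A' ++ β' ++ B')) (hne : a ≠ a') :
    A.toFinset.card = 2 ∧ B.toFinset ∩ A.toFinset = ∅ ∧ IsUniversal A.toFinset (k - 1) A := by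
  have hu := @sublist_of_head_ne _ _ _ _ _ _ _ _ _ _ _ h h' _ hk hc hne
  have h1 : a ∈ A := by
    simpa using hu (u := [a]) (by simp; omega) (by simp)
  have h2 : a' ∈ A := by
    simpa using hu (u := [a']) (by simp; omega) (by simp)
  obtain ⟨D, -, -, hb⟩ := h.last
  have hab : a ≠ b := fun e => hb (e ▸ h1)
  have hab' : a' ≠ b := fun e => hb (e ▸ h2)
  have hA : A.toFinset = {a, a'} := by
    ext c
    simp only [List.mem_toFinset, Finset.mem_insert, Finset.mem_singleton]
    constructor
    · intro hcA
      rcases eq_or_eq_of_ne hσ hne hab hab' c with e | e | e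
      · exact Or.inl e
      · exact Or.inr e
      · exact absurd (e ▸ hcA) hb
    · rintro (rfl | rfl) <;> assumption
  obtain ⟨E, -, -, haB⟩ := h.head
  refine ⟨by rw [hA, Finset.card_pair hne], ?_, ?_⟩
  · rw [hA, Finset.eq_empty_iff_forall_notMem]
    intro c hcm
    simp only [Finset.mem_inter, List.mem_toFinset, Finset.mem_insert,
      Finset.mem_singleton] at hcm
    rcases hcm with ⟨hcB, rfl | rfl⟩
    · exact haB hcB
    · exact h.not_mem_right_of_ne h' hk hc hcB
  · intro v hl hv
    exact hu hl.le fun c hcv => by simpa [hA] using hv c hcv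

/-! ### Sufficiency of the first alternative -/

/-- Here B is a power of b, so v splits as a word p over the letters of A followed by a power of b.
Universality places p, up to one letter, in A'. -/
theorem sublist_of_universal [Fintype σ] (hσ : Fintype.card σ = 3)
    (h : IsFactorization A β B a b)
    (h' : IsFactorization A' β' B' a' b') {k : ℕ} (hk : 2 ≤ k)
    (hA : A.toFinset.card = 2) (hA' : A'.toFinset = A.toFinset)
    (hAB : B.toFinset ∩ A.toFinset = ∅) (hun : IsUniversal A.toFinset (k - 1) A')
    (hB : Congr (k - 1) B B') {v : List σ} (hv : v.Sublist (A ++ β ++ B)) (hl : v.length ≤ k) :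
    v.Sublist (A' ++ β' ++ B') := by
  obtain ⟨D, rfl, hbD, hb⟩ := h.last
  obtain ⟨D', hD', -, hb'⟩ := h'.last
  -- With three letters in total, A consists of all letters except the one it misses, which forces b
  -- = b'.
  have hcompl : ∀ {b : σ}, b ∉ A → ∀ c, c ∈ A ↔ c ≠ b := by
    intro b hb
    have : A.toFinset = Finset.univ.erase b := by
      apply Finset.eq_of_subset_of_card_le
      · intro c hc
        simp only [Finset.mem_erase, Finset.mem_univ, and_true]
        rintro rfl
        exact hb (by simpa using hc)
      · rw [Finset.card_erase_of_mem (Finset.mem_univ _), Finset.card_univ, hσ, hA]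
    intro c
    rw [← List.mem_toFinset, this]
    simp
  have hbA' : b' ∉ A := by
    rw [← List.mem_toFinset, ← hA', List.mem_toFinset]; exact hb'
  have hbb : b = b' := by
    by_contra hne
    exact hb ((hcompl hbA' b).2 hne)
  subst hbb
  have hBb : ∀ c ∈ B, c = b := by
    intro c hc
    by_contra hne
    have : c ∈ B.toFinset ∩ A.toFinset := by
      simpa using ⟨hc, (hcompl hb c).2 hne⟩
    simp [hAB] at this
  have hne : A.toFinset.Nonempty := by
    rw [← Finset.card_pos]; omega
  have e : A ++ (D ++ [b]) ++ B = (A ++ D) ++ (b :: B) := by simp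
  rw [e] at hv
  obtain ⟨p, r, rfl, hp, hr⟩ := List.sublist_append_iff.1 hv
  have hpA : ∀ c ∈ p, c ∈ A.toFinset := by
    intro c hc
    rw [List.mem_toFinset, hcompl hb c]
    rintro rfl
    have := hp.subset hc
    simp only [List.mem_append] at this
    tauto
  rcases r with _ | ⟨d, r⟩
  · simp only [List.append_nil] at hl ⊢
    -- Without a b-part, p may have length k: its last letter is then taken from β'B', which
    -- contains every letter.
    rcases List.eq_nil_or_concat p with rfl | ⟨p, c, rfl⟩
    · exact List.nil_sublist _
    · rw [List.concat_eq_append] at hl hpA ⊢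
      exact h'.append_singleton_sublist (hun.sublist hne (by simp at hl; omega)
        fun x hx => hpA x (by simp [hx])) c
  · obtain rfl : d = b := by
      rcases List.mem_cons.1 (hr.subset (List.mem_cons_self (a := d))) with e | e
      · exact e
      · exact hBb _ e
    have hr' : r.Sublist B := List.cons_sublist_cons.1 hr
    simp only [List.length_append, List.length_cons] at hl
    have h1 : p.Sublist A' := hun.sublist hne (by omega) hpA
    have h2 : r.Sublist B' := hB.sublist hr' (by omega)
    have h3 : [d].Sublist β' := by simp [hD']
    simpa using (h1.append h3).append h2

theorem congr_of_universal [Fintype σ] (hσ : Fintype.card σ = 3)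
    (h : IsFactorization A β B a b)
    (h' : IsFactorization A' β' B' a' b') {k : ℕ} (hk : 2 ≤ k)
    (hAA : Congr (k - 1) A A') (hB : Congr (k - 1) B B')
    (hA : A.toFinset.card = 2)
    (hAB : B.toFinset ∩ A.toFinset = ∅) (hun : IsUniversal A.toFinset (k - 1) A) :
    Congr k (A ++ β ++ B) (A' ++ β' ++ B') := by
  have hA' : A'.toFinset = A.toFinset := by
    ext c; simp [hAA.mem_iff (by omega)]
  have hB' : B'.toFinset = B.toFinset := by
    ext c; simp [hB.mem_iff (by omega)]
  have hun' : IsUniversal A.toFinset (k - 1) A' := fun v hl hv =>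
    hAA.sublist (hun v hl hv) hl.le
  exact congr_of_sublist (fun x hx hl => h.sublist_of_universal hσ h' hk hA hA' hAB hun' hB hx hl)
    (fun x hx hl => h'.sublist_of_universal hσ h hk (by rw [hA', hA]) hA'.symm
      (by rw [hA', hB', hAB]) (by rwa [hA']) hB.symm hx hl)

end IsFactorization
end Simon

-- Exchanging outer factors, and the visibility of a power of y

namespace Simon

variable {σ : Type*}

/-- Only a factor of full length k lying entirely in A is not covered by level k - 1; its last
letter can be moved to X. -/
theorem congr_append_right {k : ℕ} (hk : 1 ≤ k) {A A' X : List σ} (h : Congr (k - 1) A A')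
    (hX : ∀ c, c ∈ X) : Congr k (A ++ X) (A' ++ X) := by
  have key : ∀ {A A' : List σ}, Congr (k - 1) A A' → ∀ v : List σ, v.Sublist (A ++ X) →
      v.length ≤ k → v.Sublist (A' ++ X) := by
    intro A A' h v hv hl
    obtain ⟨p, r, rfl, hp, hr⟩ := List.sublist_append_iff.1 hv
    simp only [List.length_append] at hl
    by_cases hp' : p.length ≤ k - 1
    · exact (h.sublist hp hp').append hr
    · obtain rfl : r = [] := List.length_eq_zero_iff.1 (by omega)
      rcases List.eq_nil_or_concat p with rfl | ⟨p, c, rfl⟩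
      · exact List.nil_sublist _
      · simp only [List.concat_eq_append, List.append_nil, List.length_append,
          List.length_singleton] at hl hp ⊢
        exact (h.sublist ((List.sublist_append_left _ _).trans hp) (by omega)).append
          (List.singleton_sublist.2 (hX c))
  exact congr_of_sublist (key h) (key h.symm)

theorem congr_append_left {k : ℕ} (hk : 1 ≤ k) {B B' X : List σ} (h : Congr (k - 1) B B')
    (hX : ∀ c, c ∈ X) : Congr k (X ++ B) (X ++ B') := by
  rw [← congr_reverse_iff]
  simpa using congr_append_right hk h.reverse (X := X.reverse) (by simpa using hX)

theorem congr_replicate_iff {j n n' : ℕ} {y : σ} :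
    Congr j (List.replicate n y) (List.replicate n' y) ↔ min n j = min n' j := by
  constructor
  · intro h
    have key : ∀ {n n' : ℕ}, Congr j (List.replicate n y) (List.replicate n' y) →
        min n j ≤ n' := by
      intro n n' h
      have := h.sublist (x := List.replicate (min n j) y)
        (List.replicate_sublist_replicate y |>.2 (min_le_left _ _)) (by simp)
      simpa using this.length_le
    have h1 := key h
    have h2 := key h.symm
    omega
  · intro h
    apply congr_of_sublist
    · intro x hx hl
      obtain ⟨m, hm, rfl⟩ := List.sublist_replicate_iff.1 hx
      simp only [List.length_replicate] at hl
      exact (List.replicate_sublist_replicate y).2 (by omega)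
    · intro x hx hl
      obtain ⟨m, hm, rfl⟩ := List.sublist_replicate_iff.1 hx
      simp only [List.length_replicate] at hl
      exact (List.replicate_sublist_replicate y).2 (by omega)

/-- Surplus y's are moved one at a time to the left while p is shorter than c₀, and otherwise to the
right. When neither side can absorb, the length bound gives j ≤ n. -/
theorem append_replicate_sublist {A B : List σ} {a b y : σ} {n k c₀ c₁ : ℕ}
    (hA : ∀ p : List σ, p.Sublist (A ++ [a]) → p.length < c₀ → (p ++ [y]).Sublist (A ++ [a]))
    (hB : ∀ r : List σ, r.Sublist (b :: B) → r.length < c₁ → (y :: r).Sublist (b :: B))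
    (hn : k - (c₀ + c₁) ≤ n) : ∀ (j : ℕ) (p r : List σ), p.Sublist (A ++ [a]) →
    r.Sublist (b :: B) → p.length + j + r.length ≤ k →
    (p ++ List.replicate j y ++ r).Sublist (A ++ [a] ++ List.replicate n y ++ b :: B) := by
  intro j
  induction j with
  | zero =>
    intro p r hp hr _
    exact (hp.append (List.replicate_sublist_replicate y |>.2 (Nat.zero_le n))).append hr
  | succ j ih =>
    intro p r hp hr hl
    by_cases hj : j + 1 ≤ n
    · exact (hp.append (List.replicate_sublist_replicate y |>.2 hj)).append hr
    · by_cases hp' : p.length < c₀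
      · have := ih (p ++ [y]) r (hA p hp hp') hr (by simp; omega)
        simpa [List.replicate_succ] using this
      · have := ih p (y :: r) hp (hB r hr (by omega)) (by simp; omega)
        simpa [List.replicate_succ'] using this

theorem congr_append_replicate {A B : List σ} {a b y : σ} {n n' k c₀ c₁ : ℕ}
    (hA : ∀ p : List σ, p.Sublist (A ++ [a]) → p.length < c₀ → (p ++ [y]).Sublist (A ++ [a]))
    (hB : ∀ r : List σ, r.Sublist (b :: B) → r.length < c₁ → (y :: r).Sublist (b :: B))
    (h : min n (k - (c₀ + c₁)) = min n' (k - (c₀ + c₁))) :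
    Congr k (A ++ [a] ++ List.replicate n y ++ b :: B)
      (A ++ [a] ++ List.replicate n' y ++ b :: B) := by
  have key : ∀ {n n' : ℕ}, min n (k - (c₀ + c₁)) = min n' (k - (c₀ + c₁)) → ∀ v : List σ,
      v.Sublist (A ++ [a] ++ List.replicate n y ++ b :: B) → v.length ≤ k →
      v.Sublist (A ++ [a] ++ List.replicate n' y ++ b :: B) := by
    intro n n' h v hv hl
    obtain ⟨q, r, rfl, hq, hr⟩ := List.sublist_append_iff.1 hv
    obtain ⟨p, m, rfl, hp, hm⟩ := List.sublist_append_iff.1 hq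
    obtain ⟨j, hj, rfl⟩ := List.sublist_replicate_iff.1 hm
    by_cases hjn : j ≤ n'
    · exact (hp.append (List.replicate_sublist_replicate y |>.2 hjn)).append hr
    · exact append_replicate_sublist hA hB (n := n') (k := k) (by omega) j p r hp hr
        (by simpa [add_assoc] using hl)
  exact congr_of_sublist (key h) (key h.symm)

/-- In any such embedding X receives at most u and Y at most v, so the middle block must hold all j
copies of y. -/
theorem le_of_append_replicate_sublist {X Y u v : List σ} {y : σ} {j n : ℕ}
    (hu : ¬ (u ++ [y]).Sublist X) (hv : ¬ (y :: v).Sublist Y)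
    (h : (u ++ List.replicate j y ++ v).Sublist (X ++ List.replicate n y ++ Y)) : j ≤ n := by
  rcases j with _ | j
  · exact Nat.zero_le _
  obtain ⟨q, r, hqr, hq, hr⟩ := List.sublist_append_iff.1 h
  obtain ⟨p, m, rfl, hp, hm⟩ := List.sublist_append_iff.1 hq
  have h1 : p.length ≤ u.length := by
    by_contra! hlt
    refine hu (List.Sublist.trans (List.IsPrefix.sublist ?_) hp)
    refine List.prefix_of_prefix_length_le (l₃ := p ++ m ++ r) ?_ ?_ (by simpa using hlt)
    · rw [← hqr]; exact ⟨List.replicate j y ++ v, by simp [List.replicate_succ]⟩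
    · exact ⟨m ++ r, by simp⟩
  have h2 : r.length ≤ v.length := by
    by_contra! hlt
    refine hv (List.Sublist.trans (List.IsSuffix.sublist ?_) hr)
    refine List.suffix_of_suffix_length_le (l₃ := p ++ m ++ r) ?_ ?_ (by simpa using hlt)
    · rw [← hqr]; exact ⟨u ++ List.replicate j y, by simp [List.replicate_succ']⟩
    · exact ⟨p ++ m, by simp⟩
  have h3 := congrArg List.length hqr
  have h4 := hm.length_le
  simp only [List.length_append, List.length_replicate] at h3 h4
  omega

/-- `u` embeds into `A a`, using the last letter `a` at most for its own last letter, and no `y`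
is left after its greedy embedding. -/
def IsBlocking (A : List σ) (a y : σ) (u : List σ) : Prop :=
  (∃ p : List σ, p.Sublist A ∧ (u = p ∨ u = p ++ [a])) ∧ ¬ (u ++ [y]).Sublist (A ++ [a])

theorem IsBlocking.sublist {A A' u : List σ} {a y : σ} {k : ℕ} (h : IsBlocking A a y u)
    (hA : Congr k A A') (hl : u.length ≤ k) : u.Sublist (A' ++ [a]) := by
  obtain ⟨⟨p, hp, rfl | rfl⟩, -⟩ := h
  · exact (hA.sublist hp hl).trans (List.sublist_append_left _ _)
  · exact (hA.sublist hp (by simp at hl; omega)).append (List.Sublist.refl _)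

/-- As y ≠ a, an embedding of `uy` into A'a would lie in A' and hence transfer to A. -/
theorem IsBlocking.not_sublist {A A' u : List σ} {a y : σ} {k : ℕ} (h : IsBlocking A a y u)
    (hA : Congr k A A') (hl : u.length + 1 ≤ k) (hy : y ≠ a) :
    ¬ (u ++ [y]).Sublist (A' ++ [a]) := by
  intro hs
  refine h.2 (List.Sublist.trans (hA.symm.sublist ?_ (by simpa using hl))
    (List.sublist_append_left _ _))
  rw [← List.reverse_sublist] at hs ⊢
  simp only [List.reverse_append, List.reverse_singleton, List.singleton_append] at hs ⊢
  cases hs with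
  | cons _ h => exact h
  | cons_cons _ h => exact absurd rfl hy

theorem IsBlocking.not_mem {A : List σ} {a y : σ} (h : IsBlocking A a y []) : y ∉ A :=
  fun hy => h.2 (by simp [hy])

theorem nonempty_of_card_eq_two {Ω : Finset σ} (hΩ : Ω.card = 2) : Ω.Nonempty := by
  rw [← Finset.card_pos]; omega

-- The threshold ι + δ of an outer factor

section arches

variable [DecidableEq σ] {Ω : Finset σ} {A : List σ} {a y : σ}

theorem eq_pair_of_mem (hΩ : Ω.card = 2) (hay : a ≠ y) (ha : a ∈ Ω) (hy : y ∈ Ω) :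
    Ω = {a, y} := by
  symm
  apply Finset.eq_of_subset_of_card_le
  · intro c hc
    simp only [Finset.mem_insert, Finset.mem_singleton] at hc
    rcases hc with rfl | rfl <;> assumption
  · rw [hΩ, Finset.card_pair hay]

/-- One arch serves each letter; if y is in the rest, the appended y is placed there and p may use
all arches. -/
theorem append_singleton_sublist_of_length_lt (hΩ : Ω.card = 2) (hay : a ≠ y)
    (hA : ∀ c ∈ A, c = a ∨ c = y) {p : List σ} (hp : p.Sublist (A ++ [a]))
    (hl : p.length < univIndex Ω A + if y ∈ rest Ω A then 1 else 0) :
    (p ++ [y]).Sublist A := by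
  have hne := nonempty_of_card_eq_two hΩ
  have hp' : ∀ c ∈ p, c = a ∨ c = y := by
    intro c hc
    have := hp.subset hc
    simp only [List.mem_append, List.mem_singleton] at this
    rcases this with h | h
    · exact hA c h
    · exact Or.inl h
  rw [univIndex_eq_length_arches hne] at hl
  by_cases hsub : Ω ⊆ A.toFinset
  · have hΩ' : Ω = {a, y} := by
      apply Finset.eq_of_subset_of_card_le
      · intro c hc
        simpa using hA c (by simpa using hsub hc)
      · rw [hΩ, Finset.card_pair hay]
    have hpΩ : ∀ c ∈ p, c ∈ Ω := fun c hc => by simpa [hΩ'] using hp' c hc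
    rw [← (arches_spec Ω hne A).1]
    split_ifs at hl with hy
    · exact (sublist_flatten_arches hne (by omega) hpΩ).append (List.singleton_sublist.2 hy)
    · refine (sublist_flatten_arches hne (by simp; omega) ?_).trans (List.sublist_append_left _ _)
      intro c hc
      rcases List.mem_append.1 hc with hc | hc
      · exact hpΩ c hc
      · simp [hΩ', List.mem_singleton.1 hc]
  -- A does not contain all of `Ω`, so there is no arch and the threshold is at most 1: only the
  -- empty p remains.
  · rw [arches_eq_nil hsub, rest_eq_self hsub] at hl
    split_ifs at hl with hy
    · obtain rfl : p = [] := List.length_eq_zero_iff.1 (Nat.lt_one_iff.1 (by simpa using hl))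
      simpa using hy
    · simp at hl

/-- The modus uses up all arches. If y is in the rest, then a is not, so one more a can only match
the a after A and skips the whole rest. -/
theorem exists_isBlocking (hΩ : Ω.card = 2) (hay : a ≠ y) (hA : A.toFinset ⊆ Ω) :
    ∃ u, IsBlocking A a y u ∧
      u.length = univIndex Ω A + if y ∈ rest Ω A then 1 else 0 := by
  have hne := nonempty_of_card_eq_two hΩ
  rw [univIndex_eq_length_arches hne, ← length_modus hne]
  obtain ⟨h1, -, h3⟩ := arches_spec Ω hne A
  have hsub : ∀ c ∈ rest Ω A, c ∈ Ω := fun c hc => hA (by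
    rw [List.mem_toFinset, ← h1]; exact List.mem_append_right _ hc)
  by_cases hy : y ∈ rest Ω A
  · have ha : a ∉ rest Ω A := by
      intro ha
      refine h3 ?_
      intro c hc
      rw [eq_pair_of_mem hΩ hay (hsub a ha) (hsub y hy)] at hc
      simp only [Finset.mem_insert, Finset.mem_singleton] at hc
      rcases hc with rfl | rfl <;> simpa using ‹_›
    refine ⟨modus Ω A ++ [a], ⟨⟨_, modus_sublist hne A, Or.inr rfl⟩, ?_⟩, by simp [hy]⟩
    rw [List.append_assoc, modus_append_sublist_iff hne, List.singleton_append,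
      cons_sublist_append_cons_iff ha]
    simp
  · refine ⟨modus Ω A, ⟨⟨_, modus_sublist hne A, Or.inl rfl⟩, ?_⟩, by simp [hy]⟩
    rw [modus_append_sublist_iff hne]
    simp [hy, hay.symm]

end arches

-- The shape of β and the comparison of cores

namespace IsFactorization

variable {A β B A' β' B' : List σ} {a b a' b' : σ}

theorem eq_singleton (h : IsFactorization A β B a a) : β = [a] := by
  obtain ⟨E, rfl, haE, -⟩ := h.head
  obtain ⟨D, hD, -, -⟩ := h.last
  rcases D with _ | ⟨d, D⟩
  · simpa using hD
  · simp only [List.cons_append, List.cons.injEq] at hD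
    exact absurd (by simp [hD.2]) haE

theorem exists_eq_append (h : IsFactorization A β B a b) (hab : a ≠ b) :
    ∃ C, β = [a] ++ C ++ [b] ∧ a ∉ C ∧ b ∉ C := by
  obtain ⟨E, rfl, haE, -⟩ := h.head
  obtain ⟨D, hD, hbD, -⟩ := h.last
  rcases D with _ | ⟨d, D⟩
  · simp only [List.nil_append, List.cons.injEq] at hD
    exact absurd hD.1 hab
  · simp only [List.cons_append, List.cons.injEq] at hD
    obtain ⟨rfl, rfl⟩ := hD
    simp only [List.mem_append, not_or, List.mem_cons] at haE hbD
    exact ⟨D, rfl, haE.1, hbD.2⟩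

theorem exists_replicate [Fintype σ] (hσ : Fintype.card σ = 3) (h : IsFactorization A β B a b)
    {y : σ} (hab : a ≠ b) (hay : a ≠ y) (hby : b ≠ y) :
    ∃ n, β = [a] ++ List.replicate n y ++ [b] := by
  obtain ⟨C, rfl, ha, hb⟩ := h.exists_eq_append hab
  refine ⟨C.length, ?_⟩
  congr 2
  refine List.eq_replicate_of_mem fun c hc => ?_
  rcases eq_or_eq_of_ne hσ hab hay hby c with rfl | rfl | rfl
  · exact absurd hc ha
  · exact absurd hc hb
  · rfl

theorem left_eq_or_eq [Fintype σ] (hσ : Fintype.card σ = 3) (h : IsFactorization A β B a b)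
    {y : σ} (hab : a ≠ b) (hay : a ≠ y) (hby : b ≠ y) : ∀ c ∈ A, c = a ∨ c = y := by
  intro c hc
  obtain ⟨-, -, -, hb⟩ := h.last
  rcases eq_or_eq_of_ne hσ hab hay hby c with rfl | rfl | rfl
  · exact Or.inl rfl
  · exact absurd hc hb
  · exact Or.inr rfl

/-- If the truncated exponents differ, then with m = min(n, n') the word u y^(m+1) v (v reversed)
has length at most k and embeds into only one of the two words. -/
theorem min_eq_min_of_congr {y : σ} {n n' k : ℕ} (hk : 2 ≤ k)
    (h' : IsFactorization A' ([a] ++ List.replicate n' y ++ [b]) B' a b)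
    (hay : a ≠ y) (hby : b ≠ y)
    (hA : Congr (k - 1) A A') (hB : Congr (k - 1) B B')
    (hc : Congr k (A ++ ([a] ++ List.replicate n y ++ [b]) ++ B)
      (A' ++ ([a] ++ List.replicate n' y ++ [b]) ++ B'))
    {u v : List σ} (hu : IsBlocking A a y u) (hv : IsBlocking B.reverse b y v) :
    min n (k - (u.length + v.length)) = min n' (k - (u.length + v.length)) := by
  have e : ∀ (X Y : List σ) (m : ℕ), X ++ ([a] ++ List.replicate m y ++ [b]) ++ Y =
      (X ++ [a]) ++ List.replicate m y ++ b :: Y := by simp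
  rw [e, e] at hc
  have hvr : ∀ {Y : List σ}, v.Sublist (Y.reverse ++ [b]) → v.reverse.Sublist (b :: Y) := by
    intro Y hY
    rw [reverse_sublist_comm]; simpa using hY
  have hvn : ∀ {Y : List σ}, ¬ (v ++ [y]).Sublist (Y.reverse ++ [b]) →
      ¬ (y :: v.reverse).Sublist (b :: Y) := by
    intro Y hY hs
    exact hY (by simpa using hs.reverse)
  by_contra hne
  have hlt : u.length + v.length + 1 ≤ k := by omega
  have hu1 := hu.sublist (A' := A) rfl (Nat.le_refl _)
  have hv1 := hvr (hv.sublist (A' := B.reverse) rfl (Nat.le_refl _))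
  have hu2 := hu.sublist hA (by omega)
  have hv2 := hvr (hv.sublist hB.reverse (by omega))
  rcases lt_or_ge n n' with hn | hn
  · have hs : (u ++ List.replicate (n + 1) y ++ v.reverse).Sublist
        ((A' ++ [a]) ++ List.replicate n' y ++ b :: B') :=
      (hu2.append (List.replicate_sublist_replicate y |>.2 hn)).append hv2
    have := le_of_append_replicate_sublist hu.2 (hvn hv.2)
      (hc.symm.sublist hs (by simp; omega))
    omega
  · have hs : (u ++ List.replicate (n' + 1) y ++ v.reverse).Sublist
        ((A ++ [a]) ++ List.replicate n y ++ b :: B) :=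
      (hu1.append (List.replicate_sublist_replicate y |>.2 (by omega))).append hv1
    -- Blocking must be transferred to A' and B' at level k - 1, which leaves one letter less for
    -- `uy` and `yv`. The spare letter is missing only if n' = 0 and u or v is empty; but then y
    -- must occur in A' and B', so neither is empty.
    have hu0 : n' = 0 → 1 ≤ u.length := by
      rintro rfl
      by_contra! h0
      obtain rfl : u = [] := List.length_eq_zero_iff.1 (by omega)
      have hyA : y ∈ A' := by simpa [hay.symm, hby.symm] using h'.left y
      exact hu.not_mem ((hA.mem_iff (by omega) y).2 hyA)
    have hv0 : n' = 0 → 1 ≤ v.length := by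
      rintro rfl
      by_contra! h0
      obtain rfl : v = [] := List.length_eq_zero_iff.1 (by omega)
      have hyB : y ∈ B' := by simpa [hay.symm, hby.symm] using h'.right y
      exact hv.not_mem (by simpa using (hB.mem_iff (by omega) y).2 hyB)
    have := le_of_append_replicate_sublist (hu.not_sublist hA (by omega) hay.symm)
      (hvn (hv.not_sublist hB.reverse (by omega) hby.symm))
      (hc.sublist hs (by simp; omega))
    omega

end IsFactorization
end Simon

-- The factorization from the definitions, and assembly of both directions

namespace Simon

variable {σ : Type*} [Fintype σ] [DecidableEq σ]

theorem exists_isFactorization {w : List σ} (hσ : Nonempty σ)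
    (hw : univIndex Finset.univ w = 1) :
    ∃ a b, IsFactorization (alpha w 0) (beta w 1) (alpha w 1) a b ∧
      w = alpha w 0 ++ beta w 1 ++ alpha w 1 ∧
      modus Finset.univ w = [b] ∧ revModus Finset.univ w = [a] := by
  have hne : (Finset.univ : Finset σ).Nonempty := Finset.univ_nonempty
  have hl := univIndex_eq_length_arches hne w
  have hl' := univIndex_eq_length_arches hne w.reverse
  rw [univIndex_reverse, hw] at hl'
  rw [hw] at hl
  obtain ⟨P, hP⟩ := List.length_eq_one_iff.1 hl.symm
  obtain ⟨Q, hQ⟩ := List.length_eq_one_iff.1 hl'.symm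
  obtain ⟨h1, h2, h3⟩ := arches_spec Finset.univ hne w
  obtain ⟨h1', h2', h3'⟩ := arches_spec Finset.univ hne w.reverse
  obtain ⟨hP1, hP2⟩ := h2 P (by simp [hP])
  obtain ⟨hQ1, hQ2⟩ := h2' Q (by simp [hQ])
  obtain ⟨D, b, rfl, hb⟩ := exists_eq_append_singleton hP1 hP2
  obtain ⟨E, a, rfl, ha⟩ := exists_eq_append_singleton hQ1 hQ2
  have hm : modus Finset.univ w = [b] := by simp [modus, hP]
  have hm' : revModus Finset.univ w = [a] := by simp [revModus, modus, hQ]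
  have hα : alpha w 0 = (rest Finset.univ w.reverse).reverse := by simp [alpha, revRest]
  have hβ : beta w 1 = (D ++ [b]).drop (alpha w 0).length := by simp [beta, hP]
  have hα1 : alpha w 1 = (a :: E.reverse).drop (beta w 1).length := by
    simp [alpha, revArches, hQ]
  rw [hP] at h1
  rw [hQ] at h1'
  have e1 : w = D ++ [b] ++ rest Finset.univ w := by simpa using h1.symm
  have e2 : w = alpha w 0 ++ a :: E.reverse := by
    rw [hα]
    have := congrArg List.reverse h1'
    simpa using this.symm
  -- The reverse rest misses a letter, so the arch D b cannot fit inside it; hence the reverse rest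
  -- is a prefix of D.
  have hS : ∃ T, D = alpha w 0 ++ T := by
    have p1 : alpha w 0 <+: w := ⟨_, e2.symm⟩
    have p2 : D <+: w := ⟨[b] ++ rest Finset.univ w, by rw [← List.append_assoc]; exact e1.symm⟩
    rcases List.prefix_or_prefix_of_prefix p1 p2 with ⟨T, hT⟩ | ⟨T, hT⟩
    · exact ⟨T, hT.symm⟩
    · rcases T with _ | ⟨t, T⟩
      · exact ⟨[], by rw [← hT]; simp⟩
      · exfalso
        have p3 : D ++ [b] <+: alpha w 0 := by
          refine List.prefix_of_prefix_length_le ⟨_, e1.symm⟩ p1 ?_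
          rw [← hT]; simp
        refine h3' fun c _ => ?_
        have := p3.subset (List.mem_toFinset.1 (hP1 (Finset.mem_univ c)))
        rw [hα] at this
        simpa using this
  obtain ⟨T, hT⟩ := hS
  have hβT : beta w 1 = T ++ [b] := by rw [hβ, hT]; simp
  have e3 : T ++ [b] ++ rest Finset.univ w = a :: E.reverse := by
    have := e1.symm.trans e2
    rw [hT] at this
    simpa using this
  have hα1R : alpha w 1 = rest Finset.univ w := by
    rw [hα1, hβT, ← e3]; simp
  have e4 : beta w 1 ++ alpha w 1 = a :: E.reverse := by rw [hβT, hα1R, e3]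
  refine ⟨a, b, ⟨?_, ⟨T, hβT, ?_, ?_⟩, ?_, ?_⟩, ?_, hm, hm'⟩
  · rcases hB : beta w 1 with _ | ⟨d, F⟩
    · simp [hB] at hβT
    · rw [hB] at e4
      simp only [List.cons_append, List.cons.injEq] at e4
      have : a ∉ F ++ alpha w 1 := by rw [e4.2]; simpa using ha
      simp only [List.mem_append, not_or] at this
      exact ⟨F, by rw [e4.1], this.1, this.2⟩
  · intro h; exact hb (by rw [hT]; simp [h])
  · intro h; exact hb (by rw [hT]; simp [h])
  · intro c
    rw [hβT, ← List.append_assoc, ← hT]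
    exact List.mem_toFinset.1 (hP1 (Finset.mem_univ c))
  · intro c
    rw [e4]
    have := List.mem_toFinset.1 (hQ1 (Finset.mem_univ c))
    simp only [List.mem_append, List.mem_singleton] at this
    simp only [List.mem_cons, List.mem_reverse]
    tauto
  · rw [List.append_assoc, e4]; exact e2

theorem exists_third (hσ : Fintype.card σ = 3) (a b : σ) : ∃ y, a ≠ y ∧ b ≠ y := by
  have : ({a, b} : Finset σ) ≠ Finset.univ := by
    intro h
    have h2 := Finset.card_le_two (a := a) (b := b)
    rw [h, Finset.card_univ] at h2
    omega
  obtain ⟨y, hy⟩ : ∃ y, y ∉ ({a, b} : Finset σ) := by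
    by_contra! h
    exact this (Finset.eq_univ_of_forall h)
  simp only [Finset.mem_insert, Finset.mem_singleton, not_or] at hy
  exact ⟨y, Ne.symm hy.1, Ne.symm hy.2⟩

namespace IsFactorization

variable {A β B A' β' B' : List σ} {a b a' b' : σ} {k : ℕ}

theorem universal_of_last_ne (hσ : Fintype.card σ = 3)
    (h : IsFactorization A β B a b)
    (h' : IsFactorization A' β' B' a' b') (hk : 2 ≤ k)
    (hc : Congr k (A ++ β ++ B) (A' ++ β' ++ B')) (hne : b ≠ b') :
    B.toFinset.card = 2 ∧ A.toFinset ∩ B.toFinset = ∅ ∧ IsUniversal B.toFinset (k - 1) B := by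
  simpa [isUniversal_reverse] using
    h.reverse.universal_of_head_ne hσ h'.reverse hk (by simpa using hc.reverse) hne

theorem congr_of_universal_right (hσ : Fintype.card σ = 3)
    (h : IsFactorization A β B a b)
    (h' : IsFactorization A' β' B' a' b') (hk : 2 ≤ k)
    (hAA : Congr (k - 1) A A') (hB : Congr (k - 1) B B')
    (hA : B.toFinset.card = 2)
    (hAB : A.toFinset ∩ B.toFinset = ∅) (hun : IsUniversal B.toFinset (k - 1) B) :
    Congr k (A ++ β ++ B) (A' ++ β' ++ B') := by
  rw [← congr_reverse_iff]
  simpa using h.reverse.congr_of_universal hσ h'.reverse hk hB.reverse hAA.reverse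
    (by simpa using hA) (by simpa using hAB) (by simpa [isUniversal_reverse] using hun)

theorem congr_core (hσ : Fintype.card σ = 3) {Ω₀ Ω₁ : Finset σ} (hk : 2 ≤ k)
    (h : IsFactorization A β B a b) (h' : IsFactorization A' β' B' a b)
    (hA : Congr (k - 1) A A') (hB : Congr (k - 1) B B')
    (hc : Congr k (A ++ β ++ B) (A' ++ β' ++ B'))
    (h₀ : Ω₀.card = 2) (hA₀ : A.toFinset ⊆ Ω₀) (h₁ : Ω₁.card = 2) (hB₁ : B.toFinset ⊆ Ω₁)
    {y : σ} (hay : a ≠ y) (hby : b ≠ y) :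
    Congr (k - (univIndex Ω₀ A + (if y ∈ rest Ω₀ A then 1 else 0) + univIndex Ω₁ B
      + (if y ∈ revRest Ω₁ B then 1 else 0))) β.tail.dropLast β'.tail.dropLast := by
  by_cases hab : a = b
  · subst hab
    rw [h.eq_singleton, h'.eq_singleton]
    rfl
  · obtain ⟨n, rfl⟩ := h.exists_replicate hσ hab hay hby
    obtain ⟨n', rfl⟩ := h'.exists_replicate hσ hab hay hby
    obtain ⟨u, hu, hul⟩ := exists_isBlocking h₀ hay hA₀
    obtain ⟨v, hv, hvl⟩ := exists_isBlocking h₁ hby (A := B.reverse) (by simpa using hB₁)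
    have := h'.min_eq_min_of_congr hk hay hby hA hB hc hu hv
    rw [hul, hvl, univIndex_reverse, ← add_assoc] at this
    have e : ∀ m, ([a] ++ List.replicate m y ++ [b]).tail.dropLast = List.replicate m y := by
      intro m; simp
    rw [e, e, congr_replicate_iff]
    simpa [revRest] using this

/-- β is exchanged first, while A and B, to which the thresholds refer, are still in place; then A
and B are exchanged in turn. -/
theorem congr_of_congr_core (hσ : Fintype.card σ = 3) {Ω₀ Ω₁ : Finset σ} (hk : 2 ≤ k)
    (h : IsFactorization A β B a b) (h' : IsFactorization A' β' B' a b)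
    (hA : Congr (k - 1) A A') (hB : Congr (k - 1) B B')
    (h₀ : Ω₀.card = 2) (h₁ : Ω₁.card = 2)
    (hc : ∀ y, a ≠ y → b ≠ y →
      Congr (k - (univIndex Ω₀ A + (if y ∈ rest Ω₀ A then 1 else 0) + univIndex Ω₁ B
      + (if y ∈ revRest Ω₁ B then 1 else 0))) β.tail.dropLast β'.tail.dropLast) :
    Congr k (A ++ β ++ B) (A' ++ β' ++ B') := by
  have hmid : Congr k (A ++ β ++ B) (A ++ β' ++ B) := by
    by_cases hab : a = b
    · subst hab
      rw [h.eq_singleton, h'.eq_singleton]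
      rfl
    · obtain ⟨y, hay, hby⟩ := exists_third hσ a b
      have hc := hc y hay hby
      have hAy := h.left_eq_or_eq hσ hab hay hby
      have hBy := h.reverse.left_eq_or_eq hσ (Ne.symm hab) hby hay
      obtain ⟨n, rfl⟩ := h.exists_replicate hσ hab hay hby
      obtain ⟨n', rfl⟩ := h'.exists_replicate hσ hab hay hby
      have e : ∀ m, ([a] ++ List.replicate m y ++ [b]).tail.dropLast = List.replicate m y := by
        intro m; simp
      rw [e, e, congr_replicate_iff] at hc
      have e : ∀ m, A ++ ([a] ++ List.replicate m y ++ [b]) ++ B =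
          A ++ [a] ++ List.replicate m y ++ b :: B := by simp
      rw [e, e]
      refine congr_append_replicate
        (c₀ := univIndex Ω₀ A + (if y ∈ rest Ω₀ A then 1 else 0))
        (c₁ := univIndex Ω₁ B + (if y ∈ revRest Ω₁ B then 1 else 0)) ?_ ?_
        (by rw [← add_assoc]; exact hc)
      · intro p hp hl
        exact (append_singleton_sublist_of_length_lt h₀ hay hAy hp hl).trans
          (List.sublist_append_left _ _)
      · intro r hr hl
        have := append_singleton_sublist_of_length_lt (A := B.reverse) (p := r.reverse) h₁ hby hBy
          (by simpa using hr.reverse) (by simpa [univIndex_reverse, revRest] using hl)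
        rw [← List.reverse_sublist] at this
        exact (by simpa using this : (y :: r).Sublist B).cons _
  refine hmid.trans (Congr.trans (v := A' ++ β' ++ B) ?_ ?_)
  · rw [List.append_assoc, List.append_assoc]
    refine congr_append_right (by omega) hA fun c => ?_
    have := h'.right c
    rw [List.mem_append] at this ⊢
    rwa [hB.mem_iff (by omega)]
  · exact congr_append_left (by omega) hB h'.left

end IsFactorization
end Simon

open Simon in
theorem mainTheorem7 {σ : Type*} [Fintype σ] [DecidableEq σ] (hσ : Fintype.card σ = 3)
    (k : ℕ) (hk : 2 ≤ k) (w w' : List σ)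
    (hw : Simon.univIndex Finset.univ w = 1) (hw' : Simon.univIndex Finset.univ w' = 1)
    -- `Ω i` is any binary alphabet containing the letters of `α_i`
    (Ω : ℕ → Finset σ)
    (hΩ : ∀ i ≤ 1, (Ω i).card = 2 ∧ (Simon.alpha w i).toFinset ⊆ Ω i) :
    Simon.Congr k w w' ↔
      (∀ i ≤ 1, Simon.Congr (k - 1) (Simon.alpha w i) (Simon.alpha w' i)) ∧
      ((∃ i ≤ 1, (Simon.alpha w i).toFinset.card = 2 ∧
          (Simon.alpha w (1 - i)).toFinset ∩ (Simon.alpha w i).toFinset = ∅ ∧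
          k - 1 ≤ Simon.univIndex (Ω i) (Simon.alpha w i)) ∨
       (Simon.modus Finset.univ w = Simon.modus Finset.univ w' ∧
        Simon.revModus Finset.univ w = Simon.revModus Finset.univ w' ∧
        -- `y` is the letter of the cores: it differs from the modus and the reverse modus
        ∀ y : σ, y ∉ Simon.modus Finset.univ w → y ∉ Simon.revModus Finset.univ w →
          Simon.Congr
            (k - (Simon.univIndex (Ω 0) (Simon.alpha w 0)
              + (if y ∈ Simon.rest (Ω 0) (Simon.alpha w 0) then 1 else 0)
              + Simon.univIndex (Ω 1) (Simon.alpha w 1)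
              + (if y ∈ Simon.revRest (Ω 1) (Simon.alpha w 1) then 1 else 0)))
            (Simon.core w 1) (Simon.core w' 1))) := by
  have hne : Nonempty σ := Fintype.card_pos_iff.1 (by omega)
  obtain ⟨a, b, h, e, hm, hr⟩ := exists_isFactorization hne hw
  obtain ⟨a', b', h', e', hm', hr'⟩ := exists_isFactorization hne hw'
  obtain ⟨h₀, hA₀⟩ := hΩ 0 (by omega)
  obtain ⟨h₁, hB₁⟩ := hΩ 1 (by omega)
  -- Two letters in α_i force `Ω i` to be exactly its set of letters.
  have hfull : ∀ i ≤ 1, (alpha w i).toFinset.card = 2 →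
      (k - 1 ≤ univIndex (Ω i) (alpha w i) ↔
        IsUniversal (alpha w i).toFinset (k - 1) (alpha w i)) := by
    intro i hi hcard
    obtain ⟨h2, hs⟩ := hΩ i hi
    rw [← Finset.eq_of_subset_of_card_le hs (by omega)]
    exact le_univIndex_iff (nonempty_of_card_eq_two hcard)
  rw [hm, hr, hm', hr']
  simp only [core, List.cons.injEq, and_true, List.mem_singleton]
  constructor
  · intro hc
    rw [e, e'] at hc
    have hA := h.congr_left h' (by omega) hc
    have hB := h.congr_right h' (by omega) hc
    refine ⟨fun i hi => ?_, ?_⟩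
    · interval_cases i <;> assumption
    by_cases haa : a = a'
    · by_cases hbb : b = b'
      · subst haa hbb
        exact Or.inr ⟨rfl, rfl, fun y hyb hya => h.congr_core hσ hk h' hA hB hc h₀ hA₀ h₁ hB₁
          (Ne.symm hya) (Ne.symm hyb)⟩
      · obtain ⟨h2, h3, h4⟩ := h.universal_of_last_ne hσ h' hk hc hbb
        exact Or.inl ⟨1, le_rfl, h2, h3, (hfull 1 le_rfl h2).2 h4⟩
    · obtain ⟨h2, h3, h4⟩ := h.universal_of_head_ne hσ h' hk hc haa
      exact Or.inl ⟨0, by omega, h2, h3, (hfull 0 (by omega) h2).2 h4⟩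
  · rintro ⟨hα, hor⟩
    have hA := hα 0 (by omega)
    have hB := hα 1 le_rfl
    rw [e, e']
    rcases hor with ⟨i, hi, h2, h3, h4⟩ | ⟨hbb, haa, hy⟩
    · rw [hfull i hi h2] at h4
      interval_cases i
      · exact h.congr_of_universal hσ h' hk hA hB h2 h3 h4
      · exact h.congr_of_universal_right hσ h' hk hA hB h2 h3 h4
    · subst hbb haa
      exact h.congr_of_congr_core hσ hk h' hA hB h₀ h₁
        fun y hay hby => hy y (Ne.symm hby) (Ne.symm hay)
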